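/- Let $n\ge 1$, and let $B_r$ be the open ball of radius $r$ centred at $0$ in $\mathbb{R}^{n+1}$, with points $x=(x',x_{n+1})\in\mathbb{R}^n\times\mathbb{R}$, and $B_r'=B_r\cap\{x_{n+1}=0\}$, regarded also as the ball $\{|x'|<r\}\subset\mathbb{R}^n$. For an obstacle $\varphi:B_1'\to\mathbb{R}$, a solution of the thin obstacle problem in $B_1$ with obstacle $\varphi$ is a function $u\in H^1(B_1)\cap C(\overline{B_1})$, even in $x_{n+1}$, such that \[ u\ge\varphi \ \text{ on } B_1',\qquad \Delta u=0\ \text{ in } B_1\setminus\Lambda(u),\qquad \Delta u\le 0\ \text{ in } B_1 \text{ in the sense of distributions}, \] where $\Lambda(u)=\{(x',0)\in B_1' : u(x',0)=\varphi(x')\}$ is the contact set. The solution is called non-trivial if $u$ is not harmonic in the whole of $B_1$ (that is, the obstacle is active). Let $\mathcal{C}\subset B_{1/2}'$ be any set that is relatively closed in $B'_{1/2}$ (in particular, any closed subset of $\mathbb{R}^n$ contained in $B'_{1/2}$). Then there exist an obstacle $\varphi\in C^\infty(B_1')$ and a non-trivial solution $u$ of the thin obstacle problem in $B_1$ with obstacle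 $\varphi$ such that $\Lambda(u)\cap B_{1/2}=\mathcal{C}$ (with $\mathcal{C}$ identified with $\mathcal{C}\times\{0\}$). -/

import Mathlib

open scoped ContDiff

namespace ThinObstacle

/-- The point `(x', t)` of `ℝⁿ × ℝ = ℝⁿ⁺¹`; the last coordinate is `x_{n+1} = t`. -/
noncomputable def point {n : ℕ} (x' : EuclideanSpace ℝ (Fin n)) (t : ℝ) :
    EuclideanSpace ℝ (Fin (n + 1)) :=
  WithLp.toLp 2 (Fin.snoc (α := fun _ => ℝ) (fun i => x' i) t)

/-- Test functions on the set `Ω`: elements of `C_c^∞(Ω)`. -/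
def IsTestFunction {d : ℕ} (Ω : Set (EuclideanSpace ℝ (Fin d)))
    (ψ : EuclideanSpace ℝ (Fin d) → ℝ) : Prop :=
  ContDiff ℝ ∞ ψ ∧ HasCompactSupport ψ ∧ tsupport ψ ⊆ Ω

/-- `G` is the weak (distributional) gradient of `u` in `Ω`. -/
def HasWeakGradient {d : ℕ} (Ω : Set (EuclideanSpace ℝ (Fin d)))
    (u : EuclideanSpace ℝ (Fin d) → ℝ)
    (G : EuclideanSpace ℝ (Fin d) → EuclideanSpace ℝ (Fin d)) : Prop :=
  ∀ ψ : EuclideanSpace ℝ (Fin d) → ℝ, IsTestFunction Ω ψ → ∀ i : Fin d,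
    ∫ x in Ω, u x * fderiv ℝ ψ x (EuclideanSpace.single i 1) = -∫ x in Ω, G x i * ψ x

/-- The Sobolev space `H¹(Ω)`. -/
def MemH1 {d : ℕ} (Ω : Set (EuclideanSpace ℝ (Fin d)))
    (u : EuclideanSpace ℝ (Fin d) → ℝ) : Prop :=
  MeasureTheory.MemLp u 2 (MeasureTheory.volume.restrict Ω) ∧
    ∃ G : EuclideanSpace ℝ (Fin d) → EuclideanSpace ℝ (Fin d),
      MeasureTheory.MemLp G 2 (MeasureTheory.volume.restrict Ω) ∧ HasWeakGradient Ω u G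

/-- `Δu ≤ 0` in `Ω` in the sense of distributions. -/
def WeakLaplacianNonpos {d : ℕ} (Ω : Set (EuclideanSpace ℝ (Fin d)))
    (u : EuclideanSpace ℝ (Fin d) → ℝ) : Prop :=
  ∀ ψ : EuclideanSpace ℝ (Fin d) → ℝ, IsTestFunction Ω ψ → (∀ x, 0 ≤ ψ x) →
    ∫ x in Ω, u x * Laplacian.laplacian ψ x ≤ 0

/-- The contact set `Λ(u) = {x' ∈ B₁' : u(x', 0) = φ(x')} × {0}`, a subset of `ℝⁿ⁺¹`. -/
def contactSet {n : ℕ} (φ : EuclideanSpace ℝ (Fin n) → ℝ)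
    (u : EuclideanSpace ℝ (Fin (n + 1)) → ℝ) : Set (EuclideanSpace ℝ (Fin (n + 1))) :=
  (fun x' => point x' 0) ''
    {x' : EuclideanSpace ℝ (Fin n) | x' ∈ Metric.ball 0 1 ∧ u (point x' 0) = φ x'}

/-- `u` is an (even) solution of the thin obstacle problem in the unit ball `B₁ ⊂ ℝⁿ⁺¹`, with
obstacle `φ` on `B₁' = {x' ∈ ℝⁿ : |x'| < 1}`, the thin ball `B₁ ∩ {x_{n+1} = 0}`. Solutions are
functions in `H¹(B₁)` that are continuous on the closed ball. -/
structure IsSolution {n : ℕ} (φ : EuclideanSpace ℝ (Fin n) → ℝ)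
    (u : EuclideanSpace ℝ (Fin (n + 1)) → ℝ) : Prop where
  continuousOn : ContinuousOn u (Metric.closedBall 0 1)
  memH1 : MemH1 (Metric.ball 0 1) u
  /-- `u` is even in `x_{n+1}`. -/
  even : ∀ (x' : EuclideanSpace ℝ (Fin n)) (t : ℝ),
    point x' t ∈ Metric.closedBall 0 1 → u (point x' (-t)) = u (point x' t)
  /-- `u ≥ φ` on `B₁ ∩ {x_{n+1} = 0}`. -/
  obstacle_le : ∀ x' ∈ Metric.ball (0 : EuclideanSpace ℝ (Fin n)) 1, φ x' ≤ u (point x' 0)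
  /-- `Δu = 0` in `B₁ \ ({x_{n+1} = 0} ∩ {u = φ})`. -/
  harmonic : InnerProductSpace.HarmonicOnNhd u (Metric.ball 0 1 \ contactSet φ u)
  /-- `Δu ≤ 0` in `B₁`. -/
  superharmonic : WeakLaplacianNonpos (Metric.ball 0 1) u

end ThinObstacle

namespace ThinObstacle

open Filter Topology MeasureTheory

/-! One fixed function `u` serves every set: `u = Re ζ^{3/2}` with `ζ = (3/5 - x_j) + i|x_{n+1}|`,
where `j` is one of the first `n` coordinates. It is harmonic off the slit `{x_{n+1} = 0, x_j ≥
3/5}`, which misses `B_{1/2}`, and it has a concave kink across the slit. On the thin ball it equals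
`(3/5 - x_j)_+^{3/2}`, which is smooth for `x_j < 3/5`. All the freedom is therefore in the
obstacle: it is the trace of `u`, cut off before `x_j = 3/5`, minus a smooth `η ≥ 0` whose zero set
is `F` together with the complement of `B'_{1/2}`. Inside `B'_{1/2}` contact means `η = 0`, that is,
membership in `F`; on the slit both the obstacle and `u` vanish, so the slit is in contact and `u`
is harmonic off the contact set.

The analytic work is to show that `u` is in `H¹` and weakly superharmonic. Both follow by replacing
`|t|` with `√(t² + ε²)`, which makes the potential `C²` with an explicitly nonpositive Laplacian
(`laplacian_slitPotential_smoothAbs_nonpos`), integrating by parts, and letting `ε → 0` by bounded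
convergence. Non-triviality is `not_harmonicAt_slitPotential`. -/

/-! ### Complex square roots and derivatives along lines. -/

/-- The square root with values in the closed first quadrant: it agrees with the principal branch on
the closed upper half-plane and is extended evenly to the lower one. -/
noncomputable def upperSqrt (z : ℂ) : ℂ :=
  ⟨√((‖z‖ + z.re) / 2), √((‖z‖ - z.re) / 2)⟩

lemma continuous_upperSqrt : Continuous upperSqrt := by
  have : upperSqrt = fun z : ℂ => ((√((‖z‖ + z.re) / 2) : ℝ) : ℂ) +
      ((√((‖z‖ - z.re) / 2) : ℝ) : ℂ) * Complex.I := by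
    ext z
    apply Complex.ext <;> simp [upperSqrt]
  rw [this]
  fun_prop

lemma upperSqrt_eq_cpow {z : ℂ} (hz : 0 ≤ z.im) : upperSqrt z = z ^ (2⁻¹ : ℂ) := by
  apply Complex.ext
  · rw [Complex.cpow_inv_two_re]; rfl
  · rw [Complex.cpow_inv_two_im_eq_sqrt hz]; rfl

lemma upperSqrt_cube_re (z : ℂ) :
    (upperSqrt z ^ 3).re = √((‖z‖ + z.re) / 2) * (2 * z.re - ‖z‖) := by
  have h1 : 0 ≤ (‖z‖ + z.re) / 2 := by
    have := (abs_le.1 (Complex.abs_re_le_norm z)).1; linarith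
  have h2 : 0 ≤ (‖z‖ - z.re) / 2 := by
    have := (abs_le.1 (Complex.abs_re_le_norm z)).2; linarith
  have e1 := Real.sq_sqrt h1
  have e2 := Real.sq_sqrt h2
  have : (upperSqrt z ^ 3).re =
      √((‖z‖ + z.re) / 2) * (√((‖z‖ + z.re) / 2) ^ 2 - 3 * √((‖z‖ - z.re) / 2) ^ 2) := by
    simp [upperSqrt, pow_succ]; ring
  rw [this, e1, e2]; ring

lemma norm_upperSqrt_sq (z : ℂ) : ‖upperSqrt z‖ ^ 2 = ‖z‖ := by
  have h1 : 0 ≤ (‖z‖ + z.re) / 2 := by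
    have := (abs_le.1 (Complex.abs_re_le_norm z)).1; linarith
  have h2 : 0 ≤ (‖z‖ - z.re) / 2 := by
    have := (abs_le.1 (Complex.abs_re_le_norm z)).2; linarith
  rw [Complex.sq_norm, Complex.normSq_apply]
  simp only [upperSqrt]
  rw [Real.mul_self_sqrt h1, Real.mul_self_sqrt h2]; ring

/-- Below the real axis the two roots are complex conjugates, which the real part does not see. The
left side is visibly continuous on all of `ℂ`; the right side is analytic on the slit plane. -/
lemma upperSqrt_cube_re_eq_cpow (z : ℂ) : (upperSqrt z ^ 3).re = ((z ^ (2⁻¹ : ℂ)) ^ 3).re := by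
  rcases le_total 0 z.im with h | h
  · rw [upperSqrt_eq_cpow h]
  · rcases h.lt_or_eq with h | h
    · have : z ^ (2⁻¹ : ℂ) = (starRingEnd ℂ) (upperSqrt z) := by
        apply Complex.ext
        · rw [Complex.cpow_inv_two_re]; rfl
        · rw [Complex.cpow_inv_two_im_eq_neg_sqrt h]; rfl
      rw [this, ← map_pow, Complex.conj_re]
    · rw [upperSqrt_eq_cpow h.ge]

lemma upperSqrt_cube_re_congr {a t s : ℝ} (h : t ^ 2 = s ^ 2) :
    (upperSqrt ⟨a, t⟩ ^ 3).re = (upperSqrt ⟨a, s⟩ ^ 3).re := by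
  have : ‖(⟨a, t⟩ : ℂ)‖ = ‖(⟨a, s⟩ : ℂ)‖ := by
    rw [Complex.norm_eq_sqrt_sq_add_sq, Complex.norm_eq_sqrt_sq_add_sq]; simp [h]
  rw [upperSqrt_cube_re, upperSqrt_cube_re, this]

lemma cpow_inv_two_sq (z : ℂ) : (z ^ (2⁻¹ : ℂ)) ^ 2 = z := by
  simp

lemma cpow_inv_two_ne_zero {z : ℂ} (hz : z ≠ 0) : z ^ (2⁻¹ : ℂ) ≠ 0 := by
  intro h
  apply hz
  rw [← cpow_inv_two_sq z, h]; simp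

lemma hasDerivAt_cpow_inv_two {z : ℂ} (hz : z ∈ Complex.slitPlane) :
    HasDerivAt (fun z : ℂ => z ^ (2⁻¹ : ℂ)) (1 / 2 * (z ^ (2⁻¹ : ℂ))⁻¹) z := by
  have h := (hasDerivAt_id z).cpow_const (c := (2⁻¹ : ℂ)) hz
  refine HasDerivAt.congr_deriv (f := fun z : ℂ => z ^ (2⁻¹ : ℂ)) h ?_
  change 2⁻¹ * z ^ ((2⁻¹ : ℂ) - 1) * 1 = _
  rw [show (2⁻¹ : ℂ) - 1 = - 2⁻¹ by norm_num, Complex.cpow_neg, mul_one, one_div]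

lemma hasDerivAt_cpow_inv_two_cube {z : ℂ} (hz : z ∈ Complex.slitPlane) :
    HasDerivAt (fun z : ℂ => (z ^ (2⁻¹ : ℂ)) ^ 3) (3 / 2 * z ^ (2⁻¹ : ℂ)) z := by
  have hz0 := cpow_inv_two_ne_zero (Complex.slitPlane_ne_zero hz)
  refine ((hasDerivAt_cpow_inv_two hz).fun_pow 3).congr_deriv ?_
  push_cast
  field_simp

/-- The second directional derivative of a `C²` function, computed along a line. -/
lemma iteratedFDeriv_two_eq_of_hasDerivAt {E : Type*} [NormedAddCommGroup E] [NormedSpace ℝ E]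
    {f : E → ℝ} {x v : E} (hf : ContDiffAt ℝ 2 f x) {g : ℝ → ℝ} {c : ℝ}
    (hg : ∀ᶠ s in 𝓝 0, HasDerivAt (fun s : ℝ => f (x + s • v)) (g s) s)
    (hc : HasDerivAt g c 0) : iteratedFDeriv ℝ 2 f x ![v, v] = c := by
  have hline (s : ℝ) : HasDerivAt (fun s : ℝ => x + s • v) v s := by
    simpa using ((hasDerivAt_id s).smul_const v).const_add x
  have hcont : Tendsto (fun s : ℝ => x + s • v) (𝓝 0) (𝓝 x) := by
    simpa using (hline 0).continuousAt.tendsto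
  have hd : ∀ᶠ y in 𝓝 x, DifferentiableAt ℝ f y := by
    filter_upwards [hf.eventually (by simp)] with y hy
    exact hy.differentiableAt (by norm_num)
  have heq : g =ᶠ[𝓝 0] fun s => fderiv ℝ f (x + s • v) v := by
    filter_upwards [hg, hcont.eventually hd] with s h1 h2
    exact h1.unique (h2.hasFDerivAt.comp_hasDerivAt s (hline s))
  have hd2 : DifferentiableAt ℝ (fderiv ℝ f) (x + (0 : ℝ) • v) := by
    simpa using (hf.fderiv_right (m := 1) (by norm_num)).differentiableAt (by norm_num)
  have h3 : HasDerivAt (fun s : ℝ => fderiv ℝ f (x + s • v) v)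
      (fderiv ℝ (fderiv ℝ f) (x + (0 : ℝ) • v) v v) 0 := by
    have := hd2.hasFDerivAt.comp_hasDerivAt (0 : ℝ) (hline 0)
    simpa using this.clm_apply (hasDerivAt_const (0 : ℝ) v)
  have := hc.unique (h3.congr_of_eventuallyEq heq)
  rw [this, iteratedFDeriv_two_apply]
  simp

/-- The first and second derivatives of `Re ζ^{3/2}` along a curve in the slit plane. -/
lemma hasDerivAt_re_cpow_curve {γ : ℝ → ℂ} {γ' : ℂ} {s : ℝ} (hs : γ s ∈ Complex.slitPlane)
    (h : HasDerivAt γ γ' s) :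
    HasDerivAt (fun s => ((γ s ^ (2⁻¹ : ℂ)) ^ 3).re) (3 / 2 * γ s ^ (2⁻¹ : ℂ) * γ').re s := by
  have := (hasDerivAt_cpow_inv_two_cube hs).comp_of_eq s h rfl
  exact Complex.reCLM.hasFDerivAt.comp_hasDerivAt s this

lemma hasDerivAt_re_cpow_curve_second {γ γ' : ℝ → ℂ} {γ'' : ℂ} {s : ℝ}
    (hs : γ s ∈ Complex.slitPlane) (h : HasDerivAt γ (γ' s) s) (h' : HasDerivAt γ' γ'' s) :
    HasDerivAt (fun s => (3 / 2 * γ s ^ (2⁻¹ : ℂ) * γ' s).re)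
      (3 / 4 * (γ s ^ (2⁻¹ : ℂ))⁻¹ * γ' s ^ 2 + 3 / 2 * γ s ^ (2⁻¹ : ℂ) * γ'').re s := by
  have h1 := (hasDerivAt_cpow_inv_two hs).comp_of_eq s h rfl
  have h2 := (h1.const_mul (3 / 2 : ℂ)).mul h'
  have h3 := Complex.reCLM.hasFDerivAt.comp_hasDerivAt s h2
  have h4 : HasDerivAt (fun s => (3 / 2 * γ s ^ (2⁻¹ : ℂ) * γ' s).re) _ s := h3
  refine h4.congr_deriv ?_
  rw [Complex.reCLM_apply]
  congr 1
  simp only [Function.comp]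
  ring

/-! ### The slit potential, its derivatives and its Laplacian. -/

section SlitPotential

/-- The point `(3/5 - x_j) + i τ(x_k)` of the complex plane. -/
noncomputable def slitCoord {d : ℕ} (j k : Fin d) (τ : ℝ → ℝ) (x : EuclideanSpace ℝ (Fin d)) : ℂ :=
  ⟨3 / 5 - x j, τ (x k)⟩

/-- The function `Re ζ^{3/2}`, where `ζ = (3/5 - x_j) + i |τ(x_k)|`. -/
noncomputable def slitPotential {d : ℕ} (j k : Fin d) (τ : ℝ → ℝ)
    (x : EuclideanSpace ℝ (Fin d)) : ℝ :=
  (upperSqrt (slitCoord j k τ x) ^ 3).re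

variable {d : ℕ} {j k : Fin d} {τ τ' : ℝ → ℝ} {x : EuclideanSpace ℝ (Fin d)}

lemma slitCoord_eq : slitCoord j k τ = fun x : EuclideanSpace ℝ (Fin d) =>
    ((3 / 5 - x j : ℝ) : ℂ) + (τ (x k) : ℂ) * Complex.I := by
  ext x
  apply Complex.ext <;> simp [slitCoord]

lemma continuous_slitCoord (hτ : Continuous τ) : Continuous (slitCoord j k τ) := by
  rw [slitCoord_eq]; fun_prop

lemma continuous_slitPotential (hτ : Continuous τ) : Continuous (slitPotential j k τ) :=
  Complex.continuous_re.comp ((continuous_upperSqrt.comp (continuous_slitCoord hτ)).pow 3)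

lemma slitPotential_eq_cpow :
    slitPotential j k τ x = ((slitCoord j k τ x ^ (2⁻¹ : ℂ)) ^ 3).re :=
  upperSqrt_cube_re_eq_cpow _

/-- This allows `τ = id` in place of `τ = |·|`: the potential is the same, while the coordinate
becomes smooth in `x`. -/
lemma slitPotential_congr_sq {σ : ℝ → ℝ} (h : τ (x k) ^ 2 = σ (x k) ^ 2) :
    slitPotential j k τ x = slitPotential j k σ x :=
  upperSqrt_cube_re_congr h

lemma contDiffAt_slitPotential (hτ : ContDiff ℝ 2 τ) (hx : slitCoord j k τ x ∈ Complex.slitPlane) :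
    ContDiffAt ℝ 2 (slitPotential j k τ) x := by
  have h1 : ContDiff ℝ 2 (slitCoord j k τ) := by
    rw [slitCoord_eq]
    have := Complex.ofRealCLM.contDiff (n := 2)
    have h3 : ContDiff ℝ 2 fun x : EuclideanSpace ℝ (Fin d) => (3 / 5 - x j : ℝ) := by fun_prop
    have h4 : ContDiff ℝ 2 fun x : EuclideanSpace ℝ (Fin d) => τ (x k) := by fun_prop
    exact (this.comp h3).add ((this.comp h4).mul contDiff_const)
  have h2 : ContDiffAt ℝ 2 (fun z : ℂ => (z ^ (2⁻¹ : ℂ)) ^ 3) (slitCoord j k τ x) := by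
    have : AnalyticAt ℂ (fun z : ℂ => (z ^ (2⁻¹ : ℂ)) ^ 3) (slitCoord j k τ x) :=
      (analyticAt_id.cpow analyticAt_const hx).pow 3
    exact this.contDiffAt.restrict_scalars ℝ
  have h3 := Complex.reCLM.contDiff.contDiffAt.comp x (h2.comp x h1.contDiffAt)
  refine h3.congr_of_eventuallyEq (Eventually.of_forall fun y => ?_)
  exact slitPotential_eq_cpow

lemma hasDerivAt_slitCoord_line (hτ : ∀ t, HasDerivAt τ (τ' t) t)
    (v : EuclideanSpace ℝ (Fin d)) (s : ℝ) :
    HasDerivAt (fun s : ℝ => slitCoord j k τ (x + s • v))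
      (-(v j : ℂ) + τ' (x k + s * v k) * v k * Complex.I) s := by
  rw [slitCoord_eq]
  have h1 : HasDerivAt (fun s : ℝ => 3 / 5 - (x j + s * v j)) (-(v j)) s := by
    simpa using (((hasDerivAt_id s).mul_const (v j)).const_add (x j)).const_sub (3 / 5)
  have h2 : HasDerivAt (fun s : ℝ => x k + s * v k) (v k) s := by
    simpa using ((hasDerivAt_id s).mul_const (v k)).const_add (x k)
  have h3 := (hτ (x k + s * v k)).comp s h2
  have := h1.ofReal_comp.add (h3.ofReal_comp.mul_const Complex.I)
  simpa [Function.comp_def] using! this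

lemma hasDerivAt_slitPotential_line (hτ : ∀ t, HasDerivAt τ (τ' t) t)
    (v : EuclideanSpace ℝ (Fin d)) {s : ℝ} (hs : slitCoord j k τ (x + s • v) ∈ Complex.slitPlane) :
    HasDerivAt (fun s : ℝ => slitPotential j k τ (x + s • v))
      (3 / 2 * slitCoord j k τ (x + s • v) ^ (2⁻¹ : ℂ) *
        (-(v j : ℂ) + τ' (x k + s * v k) * v k * Complex.I)).re s := by
  simp only [slitPotential_eq_cpow]
  exact hasDerivAt_re_cpow_curve hs (hasDerivAt_slitCoord_line hτ v s)

lemma fderiv_slitPotential (hτ2 : ContDiff ℝ 2 τ) (hτ : ∀ t, HasDerivAt τ (τ' t) t)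
    (hx : slitCoord j k τ x ∈ Complex.slitPlane) (v : EuclideanSpace ℝ (Fin d)) :
    fderiv ℝ (slitPotential j k τ) x v =
      (3 / 2 * slitCoord j k τ x ^ (2⁻¹ : ℂ) *
        (-(v j : ℂ) + τ' (x k) * v k * Complex.I)).re := by
  have h1 := hasDerivAt_slitPotential_line hτ v (x := x) (s := 0) (by simpa using hx)
  have h2 : HasDerivAt (fun s : ℝ => x + s • v) v 0 := by
    simpa using ((hasDerivAt_id (0 : ℝ)).smul_const v).const_add x
  have h3 : HasFDerivAt (slitPotential j k τ) (fderiv ℝ (slitPotential j k τ) x)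
      (x + (0 : ℝ) • v) := by
    simpa using ((contDiffAt_slitPotential hτ2 hx).differentiableAt (by norm_num)).hasFDerivAt
  have h4 := h3.comp_hasDerivAt (0 : ℝ) h2
  simpa using HasDerivAt.unique (f := fun s : ℝ => slitPotential j k τ (x + s • v)) h4 h1

lemma iteratedFDeriv_slitPotential {τ'' : ℝ} (hτ2 : ContDiff ℝ 2 τ)
    (hτ : ∀ t, HasDerivAt τ (τ' t) t) (hτ' : HasDerivAt τ' τ'' (x k))
    (hx : slitCoord j k τ x ∈ Complex.slitPlane) (v : EuclideanSpace ℝ (Fin d)) :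
    iteratedFDeriv ℝ 2 (slitPotential j k τ) x ![v, v] =
      (3 / 4 * (slitCoord j k τ x ^ (2⁻¹ : ℂ))⁻¹ * (-(v j : ℂ) + τ' (x k) * v k * Complex.I) ^ 2 +
        3 / 2 * slitCoord j k τ x ^ (2⁻¹ : ℂ) * (τ'' * v k ^ 2 * Complex.I)).re := by
  have hx0 : slitCoord j k τ (x + (0 : ℝ) • v) ∈ Complex.slitPlane := by simpa using hx
  refine iteratedFDeriv_two_eq_of_hasDerivAt (contDiffAt_slitPotential hτ2 hx)
    (g := fun s : ℝ => (3 / 2 * slitCoord j k τ (x + s • v) ^ (2⁻¹ : ℂ) *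
        (-(v j : ℂ) + τ' (x k + s * v k) * v k * Complex.I)).re) ?_ ?_
  · have hc := (hasDerivAt_slitCoord_line (j := j) (k := k) (x := x) hτ v 0).continuousAt
    filter_upwards [hc.eventually (Complex.isOpen_slitPlane.mem_nhds hx0)] with s hs
    exact hasDerivAt_slitPotential_line hτ v hs
  · have h1 : HasDerivAt (fun s : ℝ => (-(v j : ℂ) + τ' (x k + s * v k) * v k * Complex.I))
        (τ'' * v k ^ 2 * Complex.I) 0 := by
      have h2 : HasDerivAt (fun s : ℝ => x k + s * v k) (v k) 0 := by
        simpa using ((hasDerivAt_id (0 : ℝ)).mul_const (v k)).const_add (x k)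
      have h3 := HasDerivAt.comp_of_eq (0 : ℝ) hτ' h2 (by simp)
      refine (((h3.ofReal_comp.mul_const (v k : ℂ)).mul_const Complex.I).const_add
        (-(v j : ℂ))).congr_deriv ?_
      push_cast
      ring
    have := hasDerivAt_re_cpow_curve_second (γ := fun s => slitCoord j k τ (x + s • v)) hx0
      (hasDerivAt_slitCoord_line hτ v 0) h1
    simpa using this

/-- With `g(ζ) = ζ^{3/2}`, the direction `j` contributes `g''`, the direction `k` contributes `-g''
τ'² + i g' τ''`, and all others contribute zero. -/
lemma laplacian_slitPotential {τ'' : ℝ} (hjk : j ≠ k) (hτ2 : ContDiff ℝ 2 τ)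
    (hτ : ∀ t, HasDerivAt τ (τ' t) t) (hτ' : HasDerivAt τ' τ'' (x k))
    (hx : slitCoord j k τ x ∈ Complex.slitPlane) :
    Laplacian.laplacian (slitPotential j k τ) x =
      (3 / 4 * (slitCoord j k τ x ^ (2⁻¹ : ℂ))⁻¹ * (1 - τ' (x k) ^ 2) +
        3 / 2 * slitCoord j k τ x ^ (2⁻¹ : ℂ) * (τ'' * Complex.I)).re := by
  rw [InnerProductSpace.laplacian_eq_iteratedFDeriv_orthonormalBasis _
    (EuclideanSpace.basisFun (Fin d) ℝ)]
  simp only [EuclideanSpace.basisFun_apply, iteratedFDeriv_slitPotential hτ2 hτ hτ' hx]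
  rw [Finset.sum_eq_add j k hjk]
  · rw [← Complex.add_re]
    simp only [PiLp.single_apply, hjk, hjk.symm, if_true, if_false]
    congr 1
    simp [mul_pow]
    ring
  · intro i _ hi
    simp [hi.1.symm, hi.2.symm]
  · simp
  · simp

lemma harmonicAt_slitPotential (hjk : j ≠ k) (hx : slitCoord j k id x ∈ Complex.slitPlane) :
    InnerProductSpace.HarmonicAt (slitPotential j k id) x := by
  refine ⟨contDiffAt_slitPotential contDiff_id hx, ?_⟩
  filter_upwards [(continuous_slitCoord continuous_id).continuousAt.eventually
    (Complex.isOpen_slitPlane.mem_nhds hx)] with y hy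
  rw [laplacian_slitPotential hjk contDiff_id (τ' := fun _ => 1) (τ'' := 0)
    (fun t => hasDerivAt_id t) (hasDerivAt_const _ _) hy]
  simp

/-! ### The regularized potential -/

/-- A smooth, strictly positive regularization of `|t|`. -/
noncomputable def smoothAbs (ε t : ℝ) : ℝ := √(t ^ 2 + ε ^ 2)

variable {ε : ℝ}

lemma smoothAbs_pos (hε : 0 < ε) (t : ℝ) : 0 < smoothAbs ε t := Real.sqrt_pos.2 (by positivity)

lemma smoothAbs_sq (ε t : ℝ) : smoothAbs ε t ^ 2 = t ^ 2 + ε ^ 2 := Real.sq_sqrt (by positivity)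

lemma contDiff_smoothAbs (hε : 0 < ε) : ContDiff ℝ 2 (smoothAbs ε) :=
  ContDiff.sqrt (by fun_prop) fun t => by positivity

lemma continuous_smoothAbs (ε : ℝ) : Continuous (smoothAbs ε) := by
  unfold smoothAbs; fun_prop

lemma hasDerivAt_smoothAbs (hε : 0 < ε) (t : ℝ) :
    HasDerivAt (smoothAbs ε) (t / smoothAbs ε t) t := by
  have h : HasDerivAt (fun t : ℝ => t ^ 2 + ε ^ 2) (2 * t) t := by
    simpa using (hasDerivAt_pow 2 t).add_const (ε ^ 2)
  refine (h.sqrt (by positivity)).congr_deriv ?_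
  have := smoothAbs_pos hε t
  unfold smoothAbs at *
  field_simp

lemma hasDerivAt_deriv_smoothAbs (hε : 0 < ε) (t : ℝ) :
    HasDerivAt (fun t => t / smoothAbs ε t) (ε ^ 2 / smoothAbs ε t ^ 3) t := by
  have hp := smoothAbs_pos hε t
  refine ((hasDerivAt_id t).div (hasDerivAt_smoothAbs hε t) hp.ne').congr_deriv ?_
  have := smoothAbs_sq ε t
  field_simp
  simp only [id]
  linarith

lemma slitCoord_smoothAbs_mem (hε : 0 < ε) : slitCoord j k (smoothAbs ε) x ∈ Complex.slitPlane :=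
  Or.inr (smoothAbs_pos hε _).ne'

lemma contDiff_slitPotential_smoothAbs (hε : 0 < ε) :
    ContDiff ℝ 2 (slitPotential j k (smoothAbs ε)) :=
  contDiff_iff_contDiffAt.2 fun _ =>
    contDiffAt_slitPotential (contDiff_smoothAbs hε) (slitCoord_smoothAbs_mem hε)

/-- Writing `s = ζ^{1/2}` and `T = Im ζ = 2 Re s Im s`, the two terms of the Laplacian combine to
`-(3/2)(ε²/T³)(Im s)³/|s|²`, and `Im s ≥ 0` because `ζ` is in the upper half-plane. -/
lemma laplacian_slitPotential_smoothAbs_nonpos (hjk : j ≠ k) (hε : 0 < ε) :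
    Laplacian.laplacian (slitPotential j k (smoothAbs ε)) x ≤ 0 := by
  rw [laplacian_slitPotential hjk (contDiff_smoothAbs hε) (hasDerivAt_smoothAbs hε)
    (hasDerivAt_deriv_smoothAbs hε _) (slitCoord_smoothAbs_mem hε)]
  have hT := smoothAbs_pos hε (x k)
  have hT2 := smoothAbs_sq ε (x k)
  have hsq := cpow_inv_two_sq (slitCoord j k (smoothAbs ε) x)
  have hq : 0 ≤ (slitCoord j k (smoothAbs ε) x ^ (2⁻¹ : ℂ)).im := by
    rw [← upperSqrt_eq_cpow hT.le]
    exact Real.sqrt_nonneg _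
  have hne := cpow_inv_two_ne_zero (Complex.slitPlane_ne_zero
    (slitCoord_smoothAbs_mem (j := j) (k := k) (x := x) hε))
  have him : (slitCoord j k (smoothAbs ε) x).im = smoothAbs ε (x k) := rfl
  generalize slitCoord j k (smoothAbs ε) x ^ (2⁻¹ : ℂ) = s at *
  generalize smoothAbs ε (x k) = T at *
  have hpq : 2 * s.re * s.im = T := by
    rw [← him, ← hsq]; simp [pow_two]; ring
  have hN : 0 < Complex.normSq s := Complex.normSq_pos.2 hne
  have h1 : 1 - (x k / T) ^ 2 = ε ^ 2 / T ^ 2 := by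
    field_simp; linarith
  have h2 : (3 / 4 * s⁻¹ * (1 - ((x k / T : ℝ) : ℂ) ^ 2) +
      3 / 2 * s * (((ε ^ 2 / T ^ 3 : ℝ) : ℂ) * Complex.I)).re =
      3 / 4 * (s.re / Complex.normSq s) * (1 - (x k / T) ^ 2) - 3 / 2 * s.im * (ε ^ 2 / T ^ 3) := by
    have e1 : (3 / 4 * s⁻¹ * (1 - ((x k / T : ℝ) : ℂ) ^ 2)) =
        ((3 / 4 * (1 - (x k / T) ^ 2) : ℝ) : ℂ) * s⁻¹ := by push_cast; ring
    have e2 : 3 / 2 * s * (((ε ^ 2 / T ^ 3 : ℝ) : ℂ) * Complex.I) =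
        ((3 / 2 * (ε ^ 2 / T ^ 3) : ℝ) : ℂ) * (s * Complex.I) := by push_cast; ring
    rw [Complex.add_re, e1, e2, Complex.re_ofReal_mul, Complex.re_ofReal_mul, Complex.inv_re]
    simp
    ring
  rw [h2, h1]
  have h3 : 3 / 4 * (s.re / Complex.normSq s) * (ε ^ 2 / T ^ 2) - 3 / 2 * s.im * (ε ^ 2 / T ^ 3) =
      -(3 / 2 * (ε ^ 2 / T ^ 3) * s.im ^ 3 / Complex.normSq s) := by
    have hN' : Complex.normSq s = s.re * s.re + s.im * s.im := Complex.normSq_apply s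
    field_simp
    rw [hN', ← hpq]
    ring
  rw [h3]
  have := pow_nonneg hq 3
  have : 0 ≤ 3 / 2 * (ε ^ 2 / T ^ 3) * s.im ^ 3 / Complex.normSq s := by positivity
  linarith

end SlitPotential

/-! ### Integration by parts and bounded convergence. -/

section Green

variable {d : ℕ} {Ω : Set (EuclideanSpace ℝ (Fin d))} {f ψ : EuclideanSpace ℝ (Fin d) → ℝ}

lemma setIntegral_eq_integral_of_tsupport_subset {g : EuclideanSpace ℝ (Fin d) → ℝ}
    (hψ : tsupport ψ ⊆ Ω) (hg : ∀ x, x ∉ tsupport ψ → g x = 0) :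
    ∫ x in Ω, g x = ∫ x, g x :=
  setIntegral_eq_integral_of_forall_compl_eq_zero fun x hx => hg x fun h => hx (hψ h)

lemma integral_mul_fderiv_eq_neg_of_hasCompactSupport {g : EuclideanSpace ℝ (Fin d) → ℝ}
    (hf : ContDiff ℝ 1 f) (hg : ContDiff ℝ 1 g) (hc : HasCompactSupport g)
    (v : EuclideanSpace ℝ (Fin d)) :
    ∫ x, f x * fderiv ℝ g x v = -∫ x, fderiv ℝ f x v * g x := by
  have hf' : Continuous fun x => fderiv ℝ f x v :=
    (hf.continuous_fderiv (by norm_num)).clm_apply continuous_const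
  have hg' : Continuous fun x => fderiv ℝ g x v :=
    (hg.continuous_fderiv (by norm_num)).clm_apply continuous_const
  apply integral_mul_fderiv_eq_neg_fderiv_mul_of_integrable
  · exact (hf'.mul hg.continuous).integrable_of_hasCompactSupport hc.mul_left
  · exact (hf.continuous.mul hg').integrable_of_hasCompactSupport (hc.fderiv_apply ℝ v).mul_left
  · exact (hf.continuous.mul hg.continuous).integrable_of_hasCompactSupport hc.mul_left
  · exact fun x _ => hf.differentiable (by norm_num) x
  · exact fun x _ => hg.differentiable (by norm_num) x

lemma contDiff_fderiv_apply (hf : ContDiff ℝ 2 f) (v : EuclideanSpace ℝ (Fin d)) :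
    ContDiff ℝ 1 fun x => fderiv ℝ f x v :=
  (hf.fderiv_right (m := 1) (by norm_num)).clm_apply contDiff_const

lemma laplacian_eq_sum_fderiv_fderiv (hf : ContDiff ℝ 2 f) (x : EuclideanSpace ℝ (Fin d)) :
    Laplacian.laplacian f x = ∑ i, fderiv ℝ (fun y => fderiv ℝ f y (EuclideanSpace.single i 1)) x
      (EuclideanSpace.single i 1) := by
  rw [InnerProductSpace.laplacian_eq_iteratedFDeriv_orthonormalBasis _
    (EuclideanSpace.basisFun (Fin d) ℝ)]
  refine Finset.sum_congr rfl fun i _ => ?_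
  have h : DifferentiableAt ℝ (fderiv ℝ f) x :=
    ((hf.fderiv_right (m := 1) (by norm_num)).differentiable (by norm_num)) x
  rw [iteratedFDeriv_two_apply, fderiv_clm_apply h (differentiableAt_const _)]
  simp

/-- Green's second identity against a compactly supported function. -/
lemma integral_mul_laplacian_comm (hf : ContDiff ℝ 2 f) (hψ : ContDiff ℝ 2 ψ)
    (hc : HasCompactSupport ψ) :
    ∫ x, f x * Laplacian.laplacian ψ x = ∫ x, Laplacian.laplacian f x * ψ x := by
  simp only [laplacian_eq_sum_fderiv_fderiv hf, laplacian_eq_sum_fderiv_fderiv hψ, Finset.mul_sum,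
    Finset.sum_mul]
  rw [integral_finsetSum, integral_finsetSum]
  · refine Finset.sum_congr rfl fun i _ => ?_
    have hci := hc.fderiv_apply ℝ (EuclideanSpace.single i (1 : ℝ))
    rw [integral_mul_fderiv_eq_neg_of_hasCompactSupport (hf.of_le (by norm_num))
      (contDiff_fderiv_apply hψ _) hci,
      integral_mul_fderiv_eq_neg_of_hasCompactSupport (contDiff_fderiv_apply hf _)
      (hψ.of_le (by norm_num)) hc, neg_neg]
  · intro i _
    have h := (contDiff_fderiv_apply hf (EuclideanSpace.single i 1)).continuous_fderiv
      (by norm_num)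
    exact ((h.clm_apply continuous_const).mul hψ.continuous).integrable_of_hasCompactSupport
      hc.mul_left
  · intro i _
    have h := (contDiff_fderiv_apply hψ (EuclideanSpace.single i 1)).continuous_fderiv
      (by norm_num)
    exact (hf.continuous.mul (h.clm_apply continuous_const)).integrable_of_hasCompactSupport
      ((hc.fderiv_apply ℝ (EuclideanSpace.single i (1 : ℝ))).fderiv_apply ℝ
        (EuclideanSpace.single i (1 : ℝ))).mul_left

lemma continuous_laplacian (hf : ContDiff ℝ 2 f) : Continuous (Laplacian.laplacian f) := by
  rw [funext (laplacian_eq_sum_fderiv_fderiv hf)]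
  exact continuous_finsetSum _ fun i _ =>
    ((contDiff_fderiv_apply hf _).continuous_fderiv (by norm_num)).clm_apply continuous_const

lemma laplacian_eq_zero_of_notMem_tsupport {x : EuclideanSpace ℝ (Fin d)} (hx : x ∉ tsupport ψ) :
    Laplacian.laplacian ψ x = 0 := by
  have h : ψ =ᶠ[𝓝 x] fun _ => (0 : ℝ) := notMem_tsupport_iff_eventuallyEq.1 hx
  rw [(InnerProductSpace.laplacian_congr_nhds h).eq_of_nhds]
  simp

/-- Bounded convergence on the unit ball against a continuous, compactly supported function. -/
lemma tendsto_setIntegral_mul_ball {F : ℕ → EuclideanSpace ℝ (Fin d) → ℝ}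
    {h : EuclideanSpace ℝ (Fin d) → ℝ} {K : ℝ} (hF : ∀ m, Continuous (F m))
    (hb : ∀ m, ∀ x ∈ Metric.ball 0 1, |F m x| ≤ K)
    (hlim : ∀ x, Tendsto (fun m => F m x) atTop (𝓝 (f x)))
    (hh : Continuous h) (hc : HasCompactSupport h) :
    Tendsto (fun m => ∫ x in Metric.ball 0 1, F m x * h x) atTop
      (𝓝 (∫ x in Metric.ball 0 1, f x * h x)) := by
  refine tendsto_integral_of_dominated_convergence (fun x => K * |h x|) ?_ ?_ ?_ ?_
  · exact fun m => ((hF m).mul hh).aestronglyMeasurable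
  · exact ((hh.integrable_of_hasCompactSupport hc).abs.const_mul K).integrableOn
  · intro m
    filter_upwards [ae_restrict_mem measurableSet_ball] with x hx
    rw [Real.norm_eq_abs, abs_mul]
    exact mul_le_mul_of_nonneg_right (hb m x hx) (abs_nonneg _)
  · exact Eventually.of_forall fun x => (hlim x).mul_const _

end Green

/-! ### Passing to the limit: weak superharmonicity and `H¹` regularity. -/

section Approximation

variable {d : ℕ} {j k : Fin d}

lemma abs_apply_le_one {x : EuclideanSpace ℝ (Fin d)} (hx : x ∈ Metric.ball 0 1) (i : Fin d) :
    |x i| ≤ 1 :=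
  (PiLp.norm_apply_le x i).trans (mem_ball_zero_iff.1 hx).le

lemma norm_upperSqrt_slitCoord_le {τ : ℝ → ℝ} {x : EuclideanSpace ℝ (Fin d)}
    (hx : x ∈ Metric.ball 0 1) (hτ : |τ (x k)| ≤ 2) : ‖upperSqrt (slitCoord j k τ x)‖ ≤ 2 := by
  have h1 : ‖slitCoord j k τ x‖ ≤ 4 := by
    refine (Complex.norm_le_abs_re_add_abs_im _).trans ?_
    simp only [slitCoord]
    have := abs_le.1 (abs_apply_le_one hx j)
    have : |3 / 5 - x j| ≤ 2 := abs_le.2 ⟨by linarith, by linarith⟩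
    linarith
  have h2 := norm_upperSqrt_sq (slitCoord j k τ x)
  nlinarith [norm_nonneg (upperSqrt (slitCoord j k τ x))]

lemma abs_slitPotential_le {τ : ℝ → ℝ} {x : EuclideanSpace ℝ (Fin d)}
    (hx : x ∈ Metric.ball 0 1) (hτ : |τ (x k)| ≤ 2) : |slitPotential j k τ x| ≤ 8 := by
  refine (Complex.abs_re_le_norm _).trans ?_
  rw [norm_pow]
  calc _ ≤ (2 : ℝ) ^ 3 := by gcongr; exact norm_upperSqrt_slitCoord_le hx hτ
    _ = 8 := by norm_num

/-- The directional derivative of `slitPotential j k τ` in the direction `v`, where `τ'` stands for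
the derivative of `τ`. -/
noncomputable def slitGradient (j k : Fin d) (τ τ' : ℝ → ℝ) (v x : EuclideanSpace ℝ (Fin d)) : ℝ :=
  (3 / 2 * upperSqrt (slitCoord j k τ x) * (-(v j : ℂ) + τ' (x k) * v k * Complex.I)).re

lemma abs_slitGradient_le {τ τ' : ℝ → ℝ} {v x : EuclideanSpace ℝ (Fin d)}
    (hx : x ∈ Metric.ball 0 1) (hτ : |τ (x k)| ≤ 2) (hτ' : |τ' (x k)| ≤ 1) (hv : ‖v‖ ≤ 1) :
    |slitGradient j k τ τ' v x| ≤ 6 := by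
  refine (Complex.abs_re_le_norm _).trans ?_
  rw [norm_mul, norm_mul]
  have h1 := norm_upperSqrt_slitCoord_le (j := j) hx hτ
  have hvi (i : Fin d) : |v i| ≤ 1 := (PiLp.norm_apply_le v i).trans hv
  have h2 : ‖-(v j : ℂ) + τ' (x k) * v k * Complex.I‖ ≤ 2 := by
    refine (norm_add_le _ _).trans ?_
    simp only [norm_neg, norm_mul, Complex.norm_real, Complex.norm_I, Real.norm_eq_abs, mul_one]
    have := mul_le_mul hτ' (hvi k) (abs_nonneg _) zero_le_one
    linarith [hvi j]
  have h3 : ‖(3 / 2 : ℂ)‖ = 3 / 2 := by norm_num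
  rw [h3]
  calc _ ≤ 3 / 2 * 2 * (2 : ℝ) := by gcongr
    _ = 6 := by norm_num

lemma fderiv_slitPotential_smoothAbs {ε : ℝ} (hε : 0 < ε) (v x : EuclideanSpace ℝ (Fin d)) :
    fderiv ℝ (slitPotential j k (smoothAbs ε)) x v =
      slitGradient j k (smoothAbs ε) (fun t => t / smoothAbs ε t) v x := by
  rw [fderiv_slitPotential (contDiff_smoothAbs hε) (hasDerivAt_smoothAbs hε)
    (slitCoord_smoothAbs_mem hε), slitGradient, upperSqrt_eq_cpow (smoothAbs_pos hε _).le]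

lemma measurable_slitGradient {τ τ' : ℝ → ℝ} (hτ : Continuous τ) (hτ' : Measurable τ')
    (v : EuclideanSpace ℝ (Fin d)) : Measurable (slitGradient j k τ τ' v) := by
  have h1 : Measurable fun x => upperSqrt (slitCoord j k τ x) :=
    (continuous_upperSqrt.comp (continuous_slitCoord hτ)).measurable
  have h2 : Measurable fun x : EuclideanSpace ℝ (Fin d) => ((τ' (x k) : ℝ) : ℂ) :=
    Complex.measurable_ofReal.comp (hτ'.comp (by fun_prop))
  exact Complex.measurable_re.comp
    ((h1.const_mul _).mul (measurable_const.add ((h2.mul_const _).mul_const _)))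

lemma tendsto_smoothAbs (t : ℝ) :
    Tendsto (fun m : ℕ => smoothAbs (1 / ((m : ℝ) + 1)) t) atTop (𝓝 |t|) := by
  have h : Continuous fun ε => smoothAbs ε t := by unfold smoothAbs; fun_prop
  have := h.continuousAt.tendsto.comp tendsto_one_div_add_atTop_nhds_zero_nat
  simpa [smoothAbs, Real.sqrt_sq_eq_abs, Function.comp_def] using this

lemma abs_le_smoothAbs (ε t : ℝ) : |t| ≤ smoothAbs ε t :=
  Real.abs_le_sqrt (by nlinarith [sq_nonneg ε])

lemma abs_smoothAbs_le {ε t : ℝ} (hε : 0 < ε) (hε1 : ε ≤ 1) (ht : |t| ≤ 1) :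
    |smoothAbs ε t| ≤ 2 := by
  rw [abs_of_pos (smoothAbs_pos hε t)]
  have := smoothAbs_sq ε t
  have h := (sq_le_one_iff_abs_le_one t).2 ht
  have := smoothAbs_pos hε t
  nlinarith

lemma tendsto_deriv_smoothAbs (t : ℝ) :
    Tendsto (fun m : ℕ => t / smoothAbs (1 / ((m : ℝ) + 1)) t) atTop (𝓝 (t / |t|)) := by
  -- At `t = 0` every term is `0`, and so is the limit, by the convention `0 / 0 = 0`.
  rcases eq_or_ne t 0 with rfl | ht
  · simp
  · exact tendsto_const_nhds.div (tendsto_smoothAbs t) (abs_ne_zero.2 ht)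

lemma tendsto_upperSqrt_slitCoord (x : EuclideanSpace ℝ (Fin d)) :
    Tendsto (fun m : ℕ => upperSqrt (slitCoord j k (smoothAbs (1 / ((m : ℝ) + 1))) x)) atTop
      (𝓝 (upperSqrt (slitCoord j k abs x))) := by
  refine (continuous_upperSqrt.continuousAt.tendsto).comp ?_
  simp only [slitCoord_eq]
  exact tendsto_const_nhds.add
    (((Complex.continuous_ofReal.tendsto _).comp (tendsto_smoothAbs _)).mul_const _)

lemma tendsto_slitPotential (x : EuclideanSpace ℝ (Fin d)) :
    Tendsto (fun m : ℕ => slitPotential j k (smoothAbs (1 / ((m : ℝ) + 1))) x) atTop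
      (𝓝 (slitPotential j k id x)) := by
  -- The regularizations converge to `|t|`, not to `t`; the potential does not distinguish them.
  rw [slitPotential_congr_sq (σ := abs) (by simp)]
  exact (Complex.continuous_re.tendsto _).comp ((tendsto_upperSqrt_slitCoord x).pow 3)

lemma tendsto_slitGradient (v x : EuclideanSpace ℝ (Fin d)) :
    Tendsto (fun m : ℕ => slitGradient j k (smoothAbs (1 / ((m : ℝ) + 1)))
      (fun t => t / smoothAbs (1 / ((m : ℝ) + 1)) t) v x) atTop
      (𝓝 (slitGradient j k abs (fun t => t / |t|) v x)) := by
  refine (Complex.continuous_re.tendsto _).comp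
    (((tendsto_upperSqrt_slitCoord x).const_mul _).mul (tendsto_const_nhds.add ?_))
  exact (((Complex.continuous_ofReal.tendsto _).comp
    (tendsto_deriv_smoothAbs _)).mul_const _).mul_const _

lemma abs_slitPotential_smoothAbs_le (m : ℕ) {x : EuclideanSpace ℝ (Fin d)}
    (hx : x ∈ Metric.ball 0 1) :
    |slitPotential j k (smoothAbs (1 / ((m : ℝ) + 1))) x| ≤ 8 :=
  abs_slitPotential_le hx (abs_smoothAbs_le Nat.one_div_pos_of_nat
    (by rw [div_le_one (by positivity)]; linarith [(Nat.cast_nonneg m : (0 : ℝ) ≤ m)])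
    (abs_apply_le_one hx k))

lemma abs_div_smoothAbs_le (ε t : ℝ) : |t / smoothAbs ε t| ≤ 1 := by
  have h := abs_le_smoothAbs ε t
  rw [abs_div, abs_of_nonneg ((abs_nonneg t).trans h)]
  exact div_le_one_of_le₀ h ((abs_nonneg t).trans h)

lemma weakLaplacianNonpos_slitPotential (hjk : j ≠ k) :
    WeakLaplacianNonpos (Metric.ball 0 1) (slitPotential j k id) := by
  rintro ψ ⟨hψ, hc, hs⟩ hpos
  have hψ2 : ContDiff ℝ 2 ψ := contDiff_infty.1 hψ 2
  have hΔ0 : HasCompactSupport (Laplacian.laplacian ψ) :=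
    HasCompactSupport.intro hc fun x hx => laplacian_eq_zero_of_notMem_tsupport hx
  have hlim := tendsto_setIntegral_mul_ball
    (fun m : ℕ => continuous_slitPotential (j := j) (k := k)
      (continuous_smoothAbs (1 / ((m : ℝ) + 1))))
    (fun m x hx => abs_slitPotential_smoothAbs_le m hx) (tendsto_slitPotential (j := j) (k := k))
    (continuous_laplacian hψ2) hΔ0
  refine le_of_tendsto' hlim fun m => ?_
  have hε : (0 : ℝ) < 1 / ((m : ℝ) + 1) := Nat.one_div_pos_of_nat
  rw [setIntegral_eq_integral_of_tsupport_subset hs fun x hx => by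
      rw [laplacian_eq_zero_of_notMem_tsupport hx, mul_zero],
    integral_mul_laplacian_comm (contDiff_slitPotential_smoothAbs hε) hψ2 hc]
  exact integral_nonpos fun x => mul_nonpos_of_nonpos_of_nonneg
    (laplacian_slitPotential_smoothAbs_nonpos hjk hε) (hpos x)

lemma memH1_slitPotential : MemH1 (Metric.ball 0 1) (slitPotential j k id) := by
  have hfin : IsFiniteMeasure (volume.restrict
      (Metric.ball (0 : EuclideanSpace ℝ (Fin d)) 1)) :=
    ⟨by simpa using measure_ball_lt_top⟩
  refine ⟨?_, fun x => WithLp.toLp 2 fun i =>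
    slitGradient j k abs (fun t => t / |t|) (EuclideanSpace.single i 1) x, ?_, ?_⟩
  · refine MemLp.of_bound (continuous_slitPotential continuous_id).aestronglyMeasurable 8 ?_
    filter_upwards [ae_restrict_mem Metric.isOpen_ball.measurableSet] with x hx
    exact abs_slitPotential_le hx ((abs_apply_le_one hx k).trans (by norm_num))
  · refine MemLp.of_eval_piLp fun i => ?_
    have hm : Measurable (slitGradient j k abs (fun t => t / |t|) (EuclideanSpace.single i 1)) :=
      measurable_slitGradient continuous_abs (measurable_id.div continuous_abs.measurable) _
    change MemLp (slitGradient j k abs (fun t => t / |t|) (EuclideanSpace.single i 1)) 2 _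
    refine MemLp.of_bound hm.aestronglyMeasurable 6 ?_
    filter_upwards [ae_restrict_mem Metric.isOpen_ball.measurableSet] with x hx
    have h1 := abs_apply_le_one hx k
    refine abs_slitGradient_le hx (by rw [abs_abs]; linarith) ?_ (by simp)
    -- At `ε = 0` the regularization is `|t|` itself.
    simpa [smoothAbs, Real.sqrt_sq_eq_abs] using abs_div_smoothAbs_le 0 (x k)
  · rintro ψ ⟨hψ, hc, hs⟩ i
    have hψ1 : ContDiff ℝ 1 ψ := contDiff_infty.1 hψ 1
    set v : EuclideanSpace ℝ (Fin d) := EuclideanSpace.single i 1 with hv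
    have hε (m : ℕ) : (0 : ℝ) < 1 / ((m : ℝ) + 1) := Nat.one_div_pos_of_nat
    have hlim1 := tendsto_setIntegral_mul_ball
      (fun m : ℕ => continuous_slitPotential (j := j) (k := k)
        (continuous_smoothAbs (1 / ((m : ℝ) + 1))))
      (fun m x hx => abs_slitPotential_smoothAbs_le m hx) (tendsto_slitPotential (j := j) (k := k))
      ((hψ1.continuous_fderiv (by norm_num)).clm_apply (continuous_const (y := v)))
      (hc.fderiv_apply ℝ v)
    have hlim2 := tendsto_setIntegral_mul_ball (K := 6)
      (F := fun m : ℕ => slitGradient j k (smoothAbs (1 / ((m : ℝ) + 1)))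
        (fun t => t / smoothAbs (1 / ((m : ℝ) + 1)) t) v)
      (fun m => by
        rw [← funext (fderiv_slitPotential_smoothAbs (hε m) v)]
        exact ((contDiff_slitPotential_smoothAbs (hε m)).continuous_fderiv
          (by norm_num)).clm_apply continuous_const)
      (fun m x hx => abs_slitGradient_le hx (abs_smoothAbs_le (hε m)
        (by rw [div_le_one (by positivity)]; linarith [(Nat.cast_nonneg m : (0 : ℝ) ≤ m)])
        (abs_apply_le_one hx k)) (abs_div_smoothAbs_le _ _) (by simp [hv]))
      (tendsto_slitGradient v) hψ1.continuous hc
    refine tendsto_nhds_unique hlim1 (hlim2.neg.congr fun m => ?_)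
    rw [setIntegral_eq_integral_of_tsupport_subset hs fun x hx => by
        rw [image_eq_zero_of_notMem_tsupport hx, mul_zero],
      setIntegral_eq_integral_of_tsupport_subset hs fun x hx => by
        rw [fderiv_of_notMem_tsupport ℝ hx]; simp,
      integral_mul_fderiv_eq_neg_of_hasCompactSupport
        ((contDiff_slitPotential_smoothAbs (hε m)).of_le (by norm_num)) hψ1 hc]
    simp only [fderiv_slitPotential_smoothAbs (hε m)]

end Approximation

/-! ### Coordinates on the thin space. -/

section Point

variable {n : ℕ}

@[simp] lemma point_castSucc (x' : EuclideanSpace ℝ (Fin n)) (t : ℝ) (i : Fin n) :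
    point x' t i.castSucc = x' i := by
  simp [point]

@[simp] lemma point_last (x' : EuclideanSpace ℝ (Fin n)) (t : ℝ) :
    point x' t (Fin.last n) = t := by
  simp [point]

lemma norm_point_zero (x' : EuclideanSpace ℝ (Fin n)) : ‖point x' 0‖ = ‖x'‖ := by
  simp [EuclideanSpace.norm_eq, Fin.sum_univ_castSucc]

lemma exists_eq_point_zero {x : EuclideanSpace ℝ (Fin (n + 1))} (hx : x (Fin.last n) = 0) :
    ∃ x', x = point x' 0 := by
  refine ⟨WithLp.toLp 2 fun i => x i.castSucc, ?_⟩
  ext i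
  refine Fin.lastCases ?_ (fun i => ?_) i
  · rw [point_last, hx]
  · rw [point_castSucc]

end Point

/-! ### Trace on the thin space and failure of harmonicity on the slit. -/

section Trace

variable {d : ℕ} {j k : Fin d}

lemma slitPotential_of_apply_eq_zero {x : EuclideanSpace ℝ (Fin d)} (hx : x k = 0) :
    slitPotential j k id x = √(3 / 5 - x j) * (3 / 5 - x j) := by
  have h : slitCoord j k id x = ((3 / 5 - x j : ℝ) : ℂ) := by
    apply Complex.ext <;> simp [slitCoord, hx]
  rw [slitPotential, h, upperSqrt_cube_re, Complex.norm_real, Complex.ofReal_re, Real.norm_eq_abs]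
  generalize 3 / 5 - x j = ξ
  rcases le_total 0 ξ with h | h
  · rw [abs_of_nonneg h]; ring_nf
  · rw [abs_of_nonpos h, Real.sqrt_eq_zero_of_nonpos h]; simp

/-- The function is even in `s`, so a derivative at `0` would have to vanish; but it is `0` at `0`
and at least `|s|/5` in absolute value nearby. -/
lemma not_differentiableAt_upperSqrt_cube_re :
    ¬ DifferentiableAt ℝ (fun s : ℝ => (upperSqrt ⟨-1 / 5, s⟩ ^ 3).re) 0 := by
  intro h
  set f : ℝ → ℝ := fun s => (upperSqrt ⟨-1 / 5, s⟩ ^ 3).re with hf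
  have hd := h.hasDerivAt
  have heven : deriv f 0 = 0 := by
    have h1 : HasDerivAt (fun s => f (-s)) (-deriv f 0) 0 := by
      have h2 : HasDerivAt f (deriv f 0) (-0) := by simpa using hd
      simpa [Function.comp_def] using! h2.scomp (0 : ℝ) (hasDerivAt_neg (0 : ℝ))
    have h3 : (fun s => f (-s)) = f := funext fun s => upperSqrt_cube_re_congr (by ring)
    rw [h3] at h1
    have := h1.unique hd
    linarith
  have hf0 : f 0 = 0 := by
    have h1 : ‖(⟨-1 / 5, 0⟩ : ℂ)‖ = 1 / 5 := by
      rw [Complex.norm_eq_sqrt_sq_add_sq]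
      rw [show (-1 / 5 : ℝ) ^ 2 + 0 ^ 2 = (1 / 5) ^ 2 by norm_num, Real.sqrt_sq (by norm_num)]
    simp only [hf]
    rw [upperSqrt_cube_re, h1]
    norm_num
  have hbound (s : ℝ) (hs : |s| ≤ 1) : |s| / 5 ≤ |f s| := by
    simp only [hf]
    rw [upperSqrt_cube_re, Complex.norm_eq_sqrt_sq_add_sq]
    simp only
    set r := √((-1 / 5 : ℝ) ^ 2 + s ^ 2) with hr
    have hr0 : 0 ≤ r := Real.sqrt_nonneg _
    have hr2 : r ^ 2 = (-1 / 5 : ℝ) ^ 2 + s ^ 2 := Real.sq_sqrt (by positivity)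
    have hs2 : s ^ 2 ≤ 1 := (sq_le_one_iff_abs_le_one s).2 hs
    -- This gives `r + 1/5 ≤ 2`, hence `r - 1/5 = s²/(r + 1/5) ≥ s²/2`, the linear lower bound for
    -- the square root.
    have hr3 : r ≤ 9 / 5 := by nlinarith
    have hr4 : 1 / 5 ≤ r := by nlinarith [sq_nonneg s]
    have h1 : |s| / 2 ≤ √((r + -1 / 5) / 2) := by
      apply Real.le_sqrt_of_sq_le
      rw [div_pow, sq_abs]
      nlinarith
    have h2 : 2 / 5 ≤ |2 * (-1 / 5) - r| := by
      rw [abs_of_nonpos (by linarith)]; linarith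
    rw [abs_mul, abs_of_nonneg (Real.sqrt_nonneg _)]
    calc |s| / 5 = |s| / 2 * (2 / 5) := by ring
      _ ≤ _ := mul_le_mul h1 h2 (by norm_num) (Real.sqrt_nonneg _)
  rw [heven, hasDerivAt_iff_isLittleO] at hd
  have h1 := hd.def (c := 1 / 10) (by norm_num)
  obtain ⟨δ, hδ, hδ'⟩ := Metric.eventually_nhds_iff.1 h1
  have hm : 0 < min (δ / 2) 1 := by positivity
  have h2 := hδ' (y := min (δ / 2) 1) (by
    rw [Real.dist_eq, sub_zero, abs_of_pos hm]
    exact (min_le_left _ _).trans_lt (by linarith))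
  have h3 := hbound (min (δ / 2) 1) (by rw [abs_of_pos hm]; exact min_le_right _ _)
  simp only [hf0, sub_zero, smul_zero, Real.norm_eq_abs] at h2
  rw [abs_of_pos hm] at h2 h3
  linarith

/-- The point lies on the slit, at real part `3/5 - 4/5 = -1/5`; along the line transverse to the
slit the potential is not even differentiable there. -/
lemma not_harmonicAt_slitPotential (hjk : j ≠ k) :
    ¬ InnerProductSpace.HarmonicAt (slitPotential j k id)
      (EuclideanSpace.single j (4 / 5 : ℝ)) := by
  intro h
  apply not_differentiableAt_upperSqrt_cube_re
  have hd : DifferentiableAt ℝ (slitPotential j k id) (EuclideanSpace.single j (4 / 5 : ℝ) +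
      (0 : ℝ) • EuclideanSpace.single k (1 : ℝ)) := by
    simpa using h.1.differentiableAt (by norm_num)
  have hl : DifferentiableAt ℝ (fun s : ℝ => (EuclideanSpace.single j (4 / 5 : ℝ) +
      s • EuclideanSpace.single k (1 : ℝ) : EuclideanSpace ℝ (Fin d))) 0 := by fun_prop
  have := DifferentiableAt.comp (0 : ℝ) hd hl
  refine this.congr_of_eventuallyEq (Eventually.of_forall fun s => ?_)
  simp only [Function.comp, slitPotential, slitCoord]
  congr 4
  · simp [hjk]; norm_num
  · simp [hjk.symm]

end Trace

/-! ### The obstacle and its contact set. -/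

/-- An obstacle for which `slitPotential` is a solution: it is the trace of the potential, cut off
smoothly before the trace ceases to be smooth, minus the nonnegative function `η`. -/
noncomputable def slitObstacle {n : ℕ} (i : Fin n) (η : EuclideanSpace ℝ (Fin n) → ℝ)
    (x' : EuclideanSpace ℝ (Fin n)) : ℝ :=
  Real.smoothTransition (11 - 20 * x' i) * (√(3 / 5 - x' i) * (3 / 5 - x' i)) - η x'

section Obstacle

variable {n : ℕ} {i : Fin n} {η : EuclideanSpace ℝ (Fin n) → ℝ} {x' : EuclideanSpace ℝ (Fin n)}

/-- The cutoff is `1` for `x_i ≤ 1/2` and `0` for `x_i ≥ 11/20`. Since `11/20 < 3/5`, it vanishes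
near every point where the square root could fail to be smooth. -/
lemma contDiff_slitObstacle (hη : ContDiff ℝ ∞ η) : ContDiff ℝ ∞ (slitObstacle i η) := by
  refine ContDiff.sub (contDiff_iff_contDiffAt.2 fun x => ?_) hη
  have hlin : ContDiff ℝ ∞ fun x : EuclideanSpace ℝ (Fin n) => 3 / 5 - x i := by fun_prop
  rcases lt_or_ge (x i) (3 / 5) with h | h
  · have h1 : ContDiff ℝ ∞ fun x : EuclideanSpace ℝ (Fin n) =>
        Real.smoothTransition (11 - 20 * x i) :=
      Real.smoothTransition.contDiff.comp (by fun_prop)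
    exact h1.contDiffAt.mul
      ((hlin.contDiffAt.sqrt (sub_pos.2 h).ne').mul hlin.contDiffAt)
  · have hev : ∀ᶠ y : EuclideanSpace ℝ (Fin n) in 𝓝 x, 11 / 20 < y i :=
      (by fun_prop : Continuous fun y : EuclideanSpace ℝ (Fin n) => y i).continuousAt.eventually
        (lt_mem_nhds (by linarith))
    refine (contDiffAt_const (c := (0 : ℝ))).congr_of_eventuallyEq ?_
    filter_upwards [hev] with y hy
    rw [Real.smoothTransition.zero_of_nonpos (by linarith), zero_mul]

lemma slitPotential_point_zero (x' : EuclideanSpace ℝ (Fin n)) :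
    slitPotential i.castSucc (Fin.last n) id (point x' 0) =
      √(3 / 5 - x' i) * (3 / 5 - x' i) := by
  rw [slitPotential_of_apply_eq_zero (by simp)]; simp

lemma slitObstacle_le (hη : ∀ y, 0 ≤ η y) :
    slitObstacle i η x' ≤ slitPotential i.castSucc (Fin.last n) id (point x' 0) := by
  rw [slitPotential_point_zero, slitObstacle]
  have h0 : 0 ≤ √(3 / 5 - x' i) * (3 / 5 - x' i) := by
    rcases le_total 0 (3 / 5 - x' i) with h | h
    · positivity
    · rw [Real.sqrt_eq_zero_of_nonpos h, zero_mul]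
  have := mul_le_of_le_one_left h0 (Real.smoothTransition.le_one (11 - 20 * x' i))
  linarith [hη x']

lemma slitPotential_eq_slitObstacle_iff (hx : x' i ≤ 1 / 2) :
    slitPotential i.castSucc (Fin.last n) id (point x' 0) = slitObstacle i η x' ↔ η x' = 0 := by
  rw [slitPotential_point_zero, slitObstacle, Real.smoothTransition.one_of_one_le (by linarith),
    one_mul]
  constructor <;> intro h <;> linarith

lemma slitPotential_eq_slitObstacle (hx : 3 / 5 ≤ x' i) (h : η x' = 0) :
    slitPotential i.castSucc (Fin.last n) id (point x' 0) = slitObstacle i η x' := by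
  rw [slitPotential_point_zero, slitObstacle, Real.smoothTransition.zero_of_nonpos (by linarith),
    Real.sqrt_eq_zero_of_nonpos (by linarith), h]
  simp

/-- Harmonicity off the contact set requires the whole slit inside `B_1` to be in contact. Points of
the slit have norm at least `3/5 > 1/2`, so `η` vanishes there, and the cut-off trace does too. -/
lemma isSolution_slitPotential (hη : ∀ y, 0 ≤ η y) (hη0 : ∀ y, 1 / 2 ≤ ‖y‖ → η y = 0) :
    IsSolution (slitObstacle i η) (slitPotential i.castSucc (Fin.last n) id) where
  continuousOn := (continuous_slitPotential continuous_id).continuousOn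
  memH1 := memH1_slitPotential
  even x' t _ := by
    refine Eq.trans ?_ (upperSqrt_cube_re_congr (t := -t) (by simp))
    simp [slitPotential, slitCoord]
  obstacle_le x' _ := slitObstacle_le hη
  harmonic x hx := by
    refine harmonicAt_slitPotential (Fin.castSucc_ne_last i) ?_
    by_contra hs
    rw [Complex.mem_slitPlane_iff, not_or, not_lt, not_not] at hs
    obtain ⟨x', rfl⟩ := exists_eq_point_zero (x := x) hs.2
    have h1 : 3 / 5 ≤ x' i := by
      have := hs.1
      simp only [slitCoord, point_castSucc] at this
      linarith
    have h2 : 3 / 5 ≤ ‖x'‖ := h1.trans ((le_abs_self _).trans (PiLp.norm_apply_le x' i))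
    refine hx.2 ⟨x', ⟨?_, slitPotential_eq_slitObstacle h1 (hη0 x' (by linarith))⟩, rfl⟩
    simpa [norm_point_zero] using hx.1
  superharmonic := weakLaplacianNonpos_slitPotential (Fin.castSucc_ne_last i)

end Obstacle

end ThinObstacle

/-! ### Prescribing the contact set. -/

theorem mainTheorem10 (n : ℕ) (hn : 1 ≤ n) (C : Set (EuclideanSpace ℝ (Fin n)))
    (hC : ∃ F : Set (EuclideanSpace ℝ (Fin n)), IsClosed F ∧ C = F ∩ Metric.ball 0 (1 / 2)) :
    ∃ (φ : EuclideanSpace ℝ (Fin n) → ℝ) (u : EuclideanSpace ℝ (Fin (n + 1)) → ℝ),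
      ContDiffOn ℝ ∞ φ (Metric.ball 0 1) ∧
      ThinObstacle.IsSolution φ u ∧
      ¬ InnerProductSpace.HarmonicOnNhd u (Metric.ball 0 1) ∧
      ThinObstacle.contactSet φ u ∩ Metric.ball 0 (1 / 2) =
        (fun x' => ThinObstacle.point x' 0) '' C := by
  obtain ⟨F, hF, rfl⟩ := hC
  -- Every open set is the exact support (without closure) of a smooth nonnegative function; applied
  -- to `Fᶜ ∩ B'_{1/2}`, it gives an `η` that inside `B'_{1/2}` vanishes precisely on `F`.
  obtain ⟨η, hsupp, hη, hrange⟩ :=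
    (hF.isOpen_compl.inter (Metric.isOpen_ball (x := (0 : EuclideanSpace ℝ (Fin n)))
      (ε := 1 / 2))).exists_contDiff_support_eq (n := ⊤)
  have hη_zero (y : EuclideanSpace ℝ (Fin n)) : η y = 0 ↔ ¬ (y ∉ F ∧ ‖y‖ < 1 / 2) := by
    rw [← Function.notMem_support, hsupp]; simp
  have hη_nonneg (y : EuclideanSpace ℝ (Fin n)) : 0 ≤ η y := (hrange ⟨y, rfl⟩).1
  let i : Fin n := ⟨0, hn⟩
  refine ⟨ThinObstacle.slitObstacle i η, ThinObstacle.slitPotential i.castSucc (Fin.last n) id,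
    (ThinObstacle.contDiff_slitObstacle hη).contDiffOn,
    ThinObstacle.isSolution_slitPotential hη_nonneg
      fun y hy => (hη_zero y).2 fun h => absurd h.2 hy.not_gt, ?_, ?_⟩
  · intro h
    refine ThinObstacle.not_harmonicAt_slitPotential (Fin.castSucc_ne_last i) (h _ ?_)
    simp only [mem_ball_zero_iff, PiLp.norm_single]
    norm_num
  · have hcoord (y : EuclideanSpace ℝ (Fin n)) (hy : ‖y‖ < 1 / 2) : y i ≤ 1 / 2 :=
      (le_abs_self _).trans ((PiLp.norm_apply_le y i).trans hy.le)
    ext x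
    constructor
    · rintro ⟨⟨y, ⟨_, hy⟩, rfl⟩, hb⟩
      have hy2 : ‖y‖ < 1 / 2 := by
        rw [← ThinObstacle.norm_point_zero]; exact mem_ball_zero_iff.1 hb
      have h0 := (ThinObstacle.slitPotential_eq_slitObstacle_iff (hcoord y hy2)).1 hy
      refine ⟨y, ⟨?_, mem_ball_zero_iff.2 hy2⟩, rfl⟩
      by_contra hyF
      exact (hη_zero y).1 h0 ⟨hyF, hy2⟩
    · rintro ⟨y, ⟨hyF, hyb⟩, rfl⟩
      have hy2 := mem_ball_zero_iff.1 hyb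
      refine ⟨⟨y, ⟨mem_ball_zero_iff.2 (by linarith), ?_⟩, rfl⟩, ?_⟩
      · exact (ThinObstacle.slitPotential_eq_slitObstacle_iff (hcoord y hy2)).2
          ((hη_zero y).2 fun h => h.1 hyF)
      · rw [mem_ball_zero_iff]
        exact (ThinObstacle.norm_point_zero y).trans_lt hy2
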